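/- Let $(Y,\Gamma,R^+,R^-)$ be a connected sutured cobordism between sutured surfaces ($Y$ a compact oriented 3-manifold with an embedding of $F_1\sqcup -F_0$ into $\partial Y$, and $\Gamma$ a finite set of properly embedded arcs and circles dividing the complement in $\partial Y$ of the interior of $F_1\sqcup -F_0$ into $R^+$ and $R^-$; both $R^\pm$ are non-empty). Let $H=H_1(Y;\mathbb{Z})$ be written multiplicatively, $T$ its torsion subgroup, $G=H/T$, and let $\widehat Y\to Y$ be the maximal abelian cover, with deck group $H$, and $\widehat R^+$ the preimage of $R^+$. Let $\chi_1,\dots,\chi_m$ be a complete set of representatives of the characters $\chi\colon T\to\mathbb{C}^*$, where $\chi,\chi'$ are equivalent if they generate the same field $\mathbb{F}_\chi=\mathbb{Q}(\chi(T))=\mathbb{F}_{\chi'}$ and $\chi'$ is the composition of $\chi$ with an automorphism of $\mathbb{F}_\chi$ over $\mathbb{Q}$. A splitting $s\colon H\to T$ (a homomorphism with $s|_T=\mathrm{id}_T$) gives ring homomorphisms $\varphi_i\colon\mathbb{Q}[H]\to\mathbb{F}_{\chi_i}[G]$, $h\mapsto\chi_i(s(h))[h]$, which together form an isomorphism $\mathbb{Q}[H]\cong\bigoplus_i\mathbb{F}_{\chi_i}[G]$.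 For a $\mathbb{Z}[H]$-algebra $A$ let $H_*(Y,R^+;A)$ be the homology of $C_*(\widehat Y,\widehat R^+)\otimes_{\mathbb{Z}[H]}A$, and let $d=-\chi(Y,R^+)$. The $\mathbb{F}_{\chi_i}[G]$-valued Alexander function $\mathcal{A}_i\colon\bigwedge^d H_1(Y,R^+;\mathbb{F}_{\chi_i}[G])\to\mathbb{F}_{\chi_i}[G]$ is zero if $H_2(Y,R^+;\mathbb{F}_{\chi_i}[G])\neq 0$; otherwise one chooses an injective presentation matrix $M$ of deficiency $d$ (number of generators minus number of relations) for $H_1(Y,R^+;\mathbb{F}_{\chi_i}[G])$ and sets $\mathcal{A}_i(u_1\wedge\dots\wedge u_d)=\det[M\,|\,\overline u_1\cdots\overline u_d]$, where $\overline u_k$ is any expression of $u_k$ in the generators. The $\mathbb{Q}[H]$-valued Alexander function $\mathcal{A}^{\mathbb{Q}[H]}_{Y,\Gamma}$ is the composition $$\textstyle\bigwedge^d_{\mathbb{Q}[H]}H_1(Y,R^+;\mathbb{Q}[H])\cong\bigoplus_i\bigwedge^d_{\mathbb{F}_{\chi_i}[G]}H_1(Y,R^+;\mathbb{F}_{\chi_i}[G])\xrightarrow{\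 \oplus_i\mathcal{A}_i\ }\bigoplus_i\mathbb{F}_{\chi_i}[G]\cong\mathbb{Q}[H],$$ all arrows being defined with the same splitting; it is regarded up to multiplication by units of $\mathbb{Q}[H]$. Then $\mathcal{A}^{\mathbb{Q}[H]}_{Y,\Gamma}$ does not depend on the splitting: if $\mathcal{A}$ and $\mathcal{A}'$ are Alexander functions obtained with splittings $s$ and $s'$ (and with any choices of presentation matrices), there is a unit $u\in\mathbb{Q}[H]^\times$ with $\mathcal{A}'=u\,\mathcal{A}$. Moreover a function arises as an Alexander function for $s$ if and only if it arises as one for $s'$. -/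

import Mathlib

open scoped TensorProduct
open Topology

noncomputable section

namespace SuturedAlexander

universe u v w

/-! ### Homology of a chain complex of modules, and change of coefficients -/

section ChainComplexes

/-- A chain complex `⋯ → C 2 → C 1 → C 0 → 0` of modules over `R`. -/
structure ModuleComplex (R : Type u) [Ring R] where
  X : ℕ → Type v
  [addCommGroup : ∀ n, AddCommGroup (X n)]
  [module : ∀ n, Module R (X n)]
  d : ∀ n, X (n + 1) →ₗ[R] X n
  d_comp_d : ∀ n x, d n (d (n + 1) x) = 0

attribute [instance] ModuleComplex.addCommGroup ModuleComplex.module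

/-- The `n`-cycles of a complex. -/
def ModuleComplex.cycles {R : Type u} [Ring R] (C : ModuleComplex.{u, v} R) :
    (n : ℕ) → Submodule R (C.X n)
  | 0 => ⊤
  | n + 1 => LinearMap.ker (C.d n)

/-- The `n`-th homology (cycles modulo boundaries) of a complex. -/
abbrev ModuleComplex.Homology {R : Type u} [Ring R] (C : ModuleComplex.{u, v} R) (n : ℕ) :
    Type v :=
  C.cycles n ⧸ (LinearMap.range (C.d n)).submoduleOf (C.cycles n)

/-- The chain `z` is a cycle with homology class `c`. -/
def ModuleComplex.IsClassOf {R : Type u} [Ring R] (C : ModuleComplex.{u, v} R) {n : ℕ}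
    (c : C.Homology n) (z : C.X n) : Prop :=
  ∃ hz : z ∈ C.cycles n, (Submodule.Quotient.mk ⟨z, hz⟩ : C.Homology n) = c

/-- The ring `A`, viewed as an algebra over `R` through the ring homomorphism `φ : R → A`. -/
def Coeff {R : Type u} {A : Type w} [CommRing R] [CommRing A] (_φ : R →+* A) : Type w := A

instance {R : Type u} {A : Type w} [CommRing R] [CommRing A] (φ : R →+* A) :
    CommRing (Coeff φ) := inferInstanceAs (CommRing A)

instance {R : Type u} {A : Type w} [CommRing R] [CommRing A] (φ : R →+* A) :
    Algebra R (Coeff φ) := φ.toAlgebra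

variable {R : Type u} [CommRing R] (C : ModuleComplex.{u, v} R) {A B : Type w} [CommRing A]
  [CommRing B]

/-- The complex `A ⊗_R C`, where `A` is an `R`-algebra through `φ`. -/
def ModuleComplex.tensor (φ : R →+* A) : ModuleComplex.{w, max v w} (Coeff φ) where
  X n := Coeff φ ⊗[R] C.X n
  d n := (C.d n).baseChange (Coeff φ)
  d_comp_d n x := by
    induction x using TensorProduct.induction_on with
    | zero => simp
    | tmul a c => simp [C.d_comp_d]
    | add x y hx hy => simp only [map_add, hx, hy, add_zero]

/-- `H_n(A ⊗_R C)`, where `A` is an `R`-algebra through `φ`. -/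
def TwistedHomology (φ : R →+* A) (n : ℕ) : Type (max v w) := (C.tensor φ).Homology n

instance (φ : R →+* A) (n : ℕ) : AddCommGroup (TwistedHomology C φ n) :=
  inferInstanceAs (AddCommGroup ((C.tensor φ).Homology n))

instance (φ : R →+* A) (n : ℕ) : Module A (TwistedHomology C φ n) :=
  inferInstanceAs (Module (Coeff φ) ((C.tensor φ).Homology n))

/-- `ψ : A → B`, as a map between rings that are `R`-algebras through `φ` and `ψ ∘ φ`. -/
def coeffHom (φ : R →+* A) (ψ : A →+* B) : Coeff φ →+* Coeff (ψ.comp φ) := ψ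

/-- `coeffHom` is `R`-linear. -/
def coeffLinear (φ : R →+* A) (ψ : A →+* B) : Coeff φ →ₗ[R] Coeff (ψ.comp φ) where
  toFun := coeffHom φ ψ
  map_add' := map_add _
  map_smul' r a := by
    rw [Algebra.smul_def, Algebra.smul_def, map_mul]
    rfl

/-- The chain map `a ⊗ c ↦ ψ a ⊗ c` from `A ⊗_R C` to `B ⊗_R C`, which is semilinear over `ψ`. -/
def changeCoeffChain (φ : R →+* A) (ψ : A →+* B) (n : ℕ) :
    (C.tensor φ).X n →ₛₗ[coeffHom φ ψ] (C.tensor (ψ.comp φ)).X n where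
  toFun := (coeffLinear φ ψ).rTensor (C.X n)
  map_add' := map_add ((coeffLinear φ ψ).rTensor (C.X n))
  map_smul' a x := by
    change Coeff φ ⊗[R] C.X n at x
    change (coeffLinear φ ψ).rTensor (C.X n) (a • x) =
      coeffHom φ ψ a • (coeffLinear φ ψ).rTensor (C.X n) x
    induction x using TensorProduct.induction_on with
    | zero => simp
    | tmul b m =>
      simp only [TensorProduct.smul_tmul', LinearMap.rTensor_tmul, smul_eq_mul]
      congr 1
      exact map_mul (coeffHom φ ψ) a b
    | add x y hx hy => rw [smul_add, map_add, hx, hy, map_add, smul_add]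

theorem changeCoeffChain_d (φ : R →+* A) (ψ : A →+* B) (n : ℕ) (x : (C.tensor φ).X (n + 1)) :
    (C.tensor (ψ.comp φ)).d n (changeCoeffChain C φ ψ (n + 1) x) =
      changeCoeffChain C φ ψ n ((C.tensor φ).d n x) := by
  change Coeff φ ⊗[R] C.X (n + 1) at x
  induction x using TensorProduct.induction_on with
  | zero => exact ((map_zero _).trans (map_zero _).symm).trans (congrArg _ (map_zero _).symm)
  | tmul b m => rfl
  | add x y hx hy =>
    exact ((congrArg _ (map_add _ x y)).trans (map_add _ _ _)).trans
      ((congrArg₂ (· + ·) hx hy).trans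
        ((congrArg _ (map_add _ x y)).trans (map_add _ _ _)).symm)

theorem changeCoeffChain_mem_cycles (φ : R →+* A) (ψ : A →+* B) (n : ℕ)
    (x : (C.tensor φ).X n) (hx : x ∈ (C.tensor φ).cycles n) :
    changeCoeffChain C φ ψ n x ∈ (C.tensor (ψ.comp φ)).cycles n := by
  cases n with
  | zero => trivial
  | succ n =>
    have h : (C.tensor φ).d n x = 0 := hx
    show (C.tensor (ψ.comp φ)).d n _ = 0
    rw [changeCoeffChain_d, h, map_zero]

/-- The map `H_n(A ⊗_R C) → H_n(B ⊗_R C)` induced by `ψ : A → B`. -/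
def changeCoeff (φ : R →+* A) (ψ : A →+* B) (n : ℕ) :
    TwistedHomology C φ n → TwistedHomology C (ψ.comp φ) n :=
  Submodule.mapQ ((LinearMap.range ((C.tensor φ).d n)).submoduleOf ((C.tensor φ).cycles n))
    ((LinearMap.range ((C.tensor (ψ.comp φ)).d n)).submoduleOf
      ((C.tensor (ψ.comp φ)).cycles n))
    (((changeCoeffChain C φ ψ n).comp ((C.tensor φ).cycles n).subtype).codRestrict
      ((C.tensor (ψ.comp φ)).cycles n)
      (fun x => changeCoeffChain_mem_cycles C φ ψ n x.1 x.2))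
    (by
      rintro ⟨x, hx⟩ ⟨y, hy⟩
      exact ⟨changeCoeffChain C φ ψ _ y, by rw [changeCoeffChain_d, hy]; rfl⟩)

end ChainComplexes

/-! ### Singular chains -/

section SingularChains

/-- Singular `n`-simplices in `X`. -/
abbrev SingularSimplex (n : ℕ) (X : Type u) [TopologicalSpace X] : Type u :=
  C(stdSimplex ℝ (Fin (n + 1)), X)

variable {X : Type u} [TopologicalSpace X] {Z : Type v} [TopologicalSpace Z]

/-- The `i`-th face of a singular simplex. -/
def SingularSimplex.face {n : ℕ} (σ : SingularSimplex (n + 1) X) (i : Fin (n + 2)) :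
    SingularSimplex n X :=
  σ.comp ⟨stdSimplex.map i.succAbove, stdSimplex.continuous_map _⟩

/-- The boundary map on singular chains. -/
def boundary (X : Type u) [TopologicalSpace X] (n : ℕ) :
    (SingularSimplex (n + 1) X →₀ ℤ) →ₗ[ℤ] (SingularSimplex n X →₀ ℤ) :=
  Finsupp.linearCombination ℤ
    (fun σ => ∑ i : Fin (n + 2), (-1 : ℤ) ^ (i : ℕ) • Finsupp.single (σ.face i) 1)

theorem face_face {n : ℕ} (σ : SingularSimplex (n + 2) X) (i : Fin (n + 3)) (j : Fin (n + 2)) :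
    (σ.face (i.succAbove j)).face (j.predAbove i) = (σ.face i).face j := by
  ext t
  show σ (stdSimplex.map _ (stdSimplex.map _ t)) = σ (stdSimplex.map _ (stdSimplex.map _ t))
  rw [stdSimplex.map_comp_apply, stdSimplex.map_comp_apply]
  congr 2
  funext k
  exact Fin.succAbove_succAbove_succAbove_predAbove i j k

theorem boundary_boundary (n : ℕ) (c : SingularSimplex (n + 2) X →₀ ℤ) :
    boundary X n (boundary X (n + 1) c) = 0 := by
  induction c using Finsupp.induction_linear with
  | zero => simp
  | add x y hx hy => simp only [map_add, hx, hy, add_zero]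
  | single σ a =>
    simp only [boundary, Finsupp.linearCombination_single, map_smul, map_sum, one_smul]
    convert smul_zero a
    simp only [Finset.smul_sum]
    rw [← Finset.sum_product']
    refine Finset.sum_involution (fun ij _ => (ij.1.succAbove ij.2, ij.2.predAbove ij.1))
      ?_ ?_ (fun _ _ => Finset.mem_univ _) ?_
    · rintro ⟨i, j⟩ -
      simp only [face_face, smul_smul, ← add_smul, ← pow_add, Fin.neg_one_pow_succAbove_add_predAbove]
      simp
    · rintro ⟨i, j⟩ - - h
      exact Fin.succAbove_ne i j (congrArg Prod.fst h)
    · rintro ⟨i, j⟩ -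
      simp [Fin.succAbove_succAbove_predAbove, Fin.predAbove_predAbove_succAbove]

/-- The singular chains of `X` that are supported in the subset `A`. -/
def chainsIn (A : Set X) (n : ℕ) : Submodule ℤ (SingularSimplex n X →₀ ℤ) :=
  Submodule.span ℤ {c | ∃ σ : SingularSimplex n X, Set.range σ ⊆ A ∧ c = Finsupp.single σ 1}

/-- The map on singular chains that is induced by a continuous map. -/
def chainMap (f : C(X, Z)) (n : ℕ) :
    (SingularSimplex n X →₀ ℤ) →ₗ[ℤ] (SingularSimplex n Z →₀ ℤ) :=
  Finsupp.lmapDomain ℤ ℤ (fun σ => f.comp σ)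

theorem boundary_chainMap (f : C(X, Z)) (n : ℕ) (c : SingularSimplex (n + 1) X →₀ ℤ) :
    boundary Z n (chainMap f (n + 1) c) = chainMap f n (boundary X n c) := by
  induction c using Finsupp.induction_linear with
  | zero => simp
  | add x y hx hy => simp only [map_add, hx, hy]
  | single σ a =>
    have e (m : ℕ) (τ : SingularSimplex m X) (b : ℤ) :
        chainMap f m (Finsupp.single τ b) = Finsupp.single (f.comp τ) b := by simp [chainMap]
    simp only [boundary, e, Finsupp.linearCombination_single, map_smul, map_sum]
    rfl

theorem chainMap_mem_chainsIn (f : C(X, Z)) {A : Set X} {B : Set Z} (h : Set.MapsTo f A B)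
    (n : ℕ) : chainsIn A n ≤ (chainsIn B n).comap (chainMap f n) := by
  rw [chainsIn, Submodule.span_le]
  rintro _ ⟨σ, hσ, rfl⟩
  have e : chainMap f n (Finsupp.single σ 1) = Finsupp.single (f.comp σ) 1 := by simp [chainMap]
  rw [SetLike.mem_coe, Submodule.mem_comap, e]
  refine Submodule.subset_span ⟨f.comp σ, ?_, rfl⟩
  rintro _ ⟨t, rfl⟩
  exact h (hσ ⟨t, rfl⟩)

theorem boundary_mem_chainsIn (A : Set X) (n : ℕ) :
    chainsIn A (n + 1) ≤ (chainsIn A n).comap (boundary X n) := by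
  refine Submodule.span_le.2 ?_
  rintro _ ⟨σ, hσ, rfl⟩
  simp only [Submodule.comap_coe, Set.mem_preimage, SetLike.mem_coe, boundary,
    Finsupp.linearCombination_single, one_smul]
  refine Submodule.sum_mem _ fun i _ => Submodule.smul_mem _ _
    (Submodule.subset_span ⟨σ.face i, ?_, rfl⟩)
  rintro _ ⟨t, rfl⟩
  exact hσ (Set.mem_range_self _)

/-- Relative singular chains `C_n(X, A)` with integer coefficients. -/
abbrev RelChain (A : Set X) (n : ℕ) : Type u :=
  (SingularSimplex n X →₀ ℤ) ⧸ chainsIn A n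

/-- The complex of relative singular chains `C_*(X, A)` with integer coefficients. -/
def relComplex (A : Set X) : ModuleComplex.{0, u} ℤ where
  X n := RelChain A n
  d n := Submodule.mapQ _ _ (boundary X n) (boundary_mem_chainsIn A n)
  d_comp_d n x := by
    induction x using Submodule.Quotient.induction_on with | _ x
    simp [boundary_boundary]

/-- The relative singular homology `H_n(X, A)` with integer coefficients. -/
abbrev RelHomology (A : Set X) (n : ℕ) : Type u := (relComplex A).Homology n

/-- A singular chain, viewed as a relative chain. -/
abbrev relClass (A : Set X) {n : ℕ} (z : SingularSimplex n X →₀ ℤ) : (relComplex A).X n :=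
  (Submodule.Quotient.mk z : RelChain A n)

/-- The map on relative chains that is induced by a continuous map of pairs. -/
def relChainMap (f : C(X, Z)) {A : Set X} {B : Set Z} (h : Set.MapsTo f A B) (n : ℕ) :
    RelChain A n →ₗ[ℤ] RelChain B n :=
  Submodule.mapQ _ _ (chainMap f n) (chainMap_mem_chainsIn f h n)

/-- The group `H = H_1(X; ℤ)`, written multiplicatively. -/
abbrev H1 (X : Type u) [TopologicalSpace X] : Type u :=
  Multiplicative (RelHomology (∅ : Set X) 1)

/-- `-χ(Y, R)` for a pair `(Y, R)` of dimension at most three. -/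
def deficiency (R : Set X) : ℤ :=
  -∑ n ∈ Finset.range 4, (-1 : ℤ) ^ n * (Module.finrank ℤ (RelHomology R n) : ℤ)

end SingularChains

/-! ### Manifolds with boundary, sutured surfaces and sutured cobordisms -/

section Cobordisms

/-- The points of an `n`-manifold with boundary that have no Euclidean neighbourhood. -/
def manifoldBoundary (n : ℕ) (X : Type u) [TopologicalSpace X] : Set X :=
  {x | ¬ ∃ e : OpenPartialHomeomorph X (EuclideanSpace ℝ (Fin n)), x ∈ e.source}

/-- `X` is a compact topological `n`-manifold, possibly with boundary. -/
structure IsCompactManifold (n : ℕ) [NeZero n] (X : Type u) [TopologicalSpace X] : Prop where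
  compact : CompactSpace X
  hausdorff : T2Space X
  charts : Nonempty (ChartedSpace (EuclideanHalfSpace n) X)

/-- An orientation of an `n`-manifold: a locally constant choice of a generator `cls x` of the
local homology `H_n(X, X ∖ {x})` at the interior points `x`. (The local homology vanishes at
boundary points.) -/
structure Orientation (n : ℕ) (X : Type u) [TopologicalSpace X] where
  cls : ∀ x : X, RelHomology ({x}ᶜ : Set X) n
  generator : ∀ x ∉ manifoldBoundary n X, Submodule.span ℤ {cls x} = ⊤
  locallyConstant : ∀ x ∉ manifoldBoundary n X, ∃ U : Set X, IsOpen U ∧ x ∈ U ∧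
    ∃ z : SingularSimplex n X →₀ ℤ, ∀ y ∈ U, y ∉ manifoldBoundary n X →
      (relComplex {y}ᶜ).IsClassOf (cls y) (relClass {y}ᶜ z)

/-- `ι` carries the surface `F` with the orientation `oF` into the boundary of the 3-manifold `Y`
with the orientation `oY`; the boundary orientation (outward normal first) agrees with `ε` times
the orientation of `F`. Near an interior point of `F` the orientation of `Y` is represented by a
chain whose boundary consists of `ε` times a chain in `F` that represents the orientation of `F`,
and of a chain away from the point. -/
def IsOrientedBoundaryEmbedding {F : Type u} [TopologicalSpace F] {Y : Type v}
    [TopologicalSpace Y] (oF : Orientation 2 F) (oY : Orientation 3 Y) (ε : ℤ) (ι : C(F, Y)) :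
    Prop :=
  IsEmbedding ι ∧ Set.range ι ⊆ manifoldBoundary 3 Y ∧
  ∀ x ∉ manifoldBoundary 2 F, ∃ U : Set Y, IsOpen U ∧ ι x ∈ U ∧
    ∃ (z : SingularSimplex 3 Y →₀ ℤ) (f : SingularSimplex 2 F →₀ ℤ),
      boundary Y 2 z - ε • chainMap ι 2 f ∈ chainsIn Uᶜ 2 ∧
      (∀ y ∈ U, y ∉ manifoldBoundary 3 Y → (relComplex {y}ᶜ).IsClassOf (oY.cls y) (relClass {y}ᶜ z)) ∧
      (relComplex {x}ᶜ).IsClassOf (oF.cls x) (relClass {x}ᶜ f)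

/-- The closed sets `Rp` and `Rm` divide the set `B` and alternate across `Γ`. -/
structure IsSuturing {X : Type u} [TopologicalSpace X] (B Γ Rp Rm : Set X) : Prop where
  isClosed_plus : IsClosed Rp
  isClosed_minus : IsClosed Rm
  union_eq : Rp ∪ Rm = B
  inter_eq : Rp ∩ Rm = Γ
  alternate_plus : Γ ⊆ closure (Rp \ Γ)
  alternate_minus : Γ ⊆ closure (Rm \ Γ)
  component_plus : ∀ x : X, (connectedComponent x ∩ Rp).Nonempty
  component_minus : ∀ x : X, (connectedComponent x ∩ Rm).Nonempty

/-- A sutured surface `(F, Λ, S⁺, S⁻)`. -/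
structure SuturedSurface (F : Type u) [TopologicalSpace F] where
  manifold : IsCompactManifold 2 F
  orientation : Orientation 2 F
  Λ : Set F
  Sp : Set F
  Sm : Set F
  finite_Λ : Λ.Finite
  suturing : IsSuturing (manifoldBoundary 2 F) Λ Sp Sm

/-- A sutured cobordism `(Y, Γ, R⁺, R⁻)` from `(F₀, Λ₀)` to `(F₁, Λ₁)`: a compact oriented
3-manifold with an embedding of `F₁ ⊔ -F₀` into its boundary. The set `Γ` is a compact 1-manifold,
that is, a finite union of disjoint arcs and circles, with boundary `Λ₁ ⊔ Λ₀`; the regions `R⁺`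
and `R⁻` divide the complement in `∂Y` of the interior of `F₁ ⊔ -F₀`. -/
structure SuturedCobordism {F₀ : Type u} {F₁ : Type v} [TopologicalSpace F₀]
    [TopologicalSpace F₁] (S₀ : SuturedSurface F₀) (S₁ : SuturedSurface F₁)
    (Y : Type w) [TopologicalSpace Y] where
  manifold : IsCompactManifold 3 Y
  orientation : Orientation 3 Y
  ι₀ : C(F₀, Y)
  ι₁ : C(F₁, Y)
  embedding₀ : IsOrientedBoundaryEmbedding S₀.orientation orientation (-1) ι₀
  embedding₁ : IsOrientedBoundaryEmbedding S₁.orientation orientation 1 ι₁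
  disjoint : Disjoint (Set.range ι₀) (Set.range ι₁)
  Γ : Set Y
  Rp : Set Y
  Rm : Set Y
  manifold_Γ : IsCompactManifold 1 Γ
  boundary_Γ : Subtype.val '' manifoldBoundary 1 Γ = ι₀ '' S₀.Λ ∪ ι₁ '' S₁.Λ
  suturing : IsSuturing
    (manifoldBoundary 3 Y \ (ι₀ '' (manifoldBoundary 2 F₀)ᶜ ∪ ι₁ '' (manifoldBoundary 2 F₁)ᶜ))
    Γ Rp Rm
  Rp_inter₀ : Rp ∩ Set.range ι₀ = ι₀ '' S₀.Sp
  Rp_inter₁ : Rp ∩ Set.range ι₁ = ι₁ '' S₁.Sp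
  Rm_inter₀ : Rm ∩ Set.range ι₀ = ι₀ '' S₀.Sm
  Rm_inter₁ : Rm ∩ Set.range ι₁ = ι₁ '' S₁.Sm

end Cobordisms

/-! ### The maximal abelian cover -/

section Covers

/-- A maximal abelian cover of `Y`: a path connected covering space on which `H = H_1(Y)` acts
as the group of deck transformations, in such a way that a path in the cover which projects to a
loop of class `h` joins its initial point `x` to `h • x`. -/
structure MaximalAbelianCover (Y : Type u) [TopologicalSpace Y] where
  Total : Type v
  [topology : TopologicalSpace Total]
  [action : MulAction (H1 Y) Total]
  proj : C(Total, Y)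
  pathConnected : PathConnectedSpace Total
  isQuotientCoveringMap : IsQuotientCoveringMap proj (H1 Y)
  monodromy : ∀ (σ : SingularSimplex 1 Total) (c : RelHomology (∅ : Set Y) 1),
    (relComplex ∅).IsClassOf c (relClass ∅ (Finsupp.single (proj.comp σ) 1)) →
      Multiplicative.ofAdd c • σ (stdSimplex.vertex 0) = σ (stdSimplex.vertex 1)

attribute [instance] MaximalAbelianCover.topology MaximalAbelianCover.action

variable {Y : Type u} [TopologicalSpace Y] (P : MaximalAbelianCover.{u, v} Y)

instance : ContinuousConstSMul (H1 Y) P.Total :=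
  P.isQuotientCoveringMap.toContinuousConstSMul

/-- The deck transformation given by `h`. -/
def MaximalAbelianCover.deck (h : H1 Y) : C(P.Total, P.Total) := ⟨(h • ·), continuous_const_smul h⟩

/-- The preimage of a subset in the cover. -/
abbrev MaximalAbelianCover.lift (R : Set Y) : Set P.Total := P.proj ⁻¹' R

theorem MaximalAbelianCover.deck_mapsTo (R : Set Y) (h : H1 Y) :
    Set.MapsTo (P.deck h) (P.lift R) (P.lift R) := by
  intro x hx
  have : P.proj (h • x) = P.proj x := P.isQuotientCoveringMap.map_smul h
  show P.proj (h • x) ∈ R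
  rw [this]
  exact hx

/-- The action of `H` on the relative singular chains of the cover. -/
def deckRep (R : Set Y) (n : ℕ) : Representation ℤ (H1 Y) (RelChain (P.lift R) n) where
  toFun h := relChainMap (P.deck h) (P.deck_mapsTo R h) n
  map_one' := by
    refine LinearMap.ext fun x => ?_
    induction x using Submodule.Quotient.induction_on with | _ x
    show (Submodule.Quotient.mk (chainMap (P.deck 1) n x) : RelChain (P.lift R) n) = _
    congr 1
    have : (fun σ : SingularSimplex n P.Total => (P.deck 1).comp σ) = id := by
      funext σ
      ext t
      exact one_smul _ _
    simp only [chainMap, Finsupp.lmapDomain_apply]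
    rw [this, Finsupp.mapDomain_id]
  map_mul' g h := by
    refine LinearMap.ext fun x => ?_
    induction x using Submodule.Quotient.induction_on with | _ x
    show (Submodule.Quotient.mk (chainMap (P.deck (g * h)) n x) : RelChain (P.lift R) n) =
      Submodule.Quotient.mk (chainMap (P.deck g) n (chainMap (P.deck h) n x))
    congr 1
    have : (fun σ : SingularSimplex n P.Total => (P.deck (g * h)).comp σ) =
        (fun σ => (P.deck g).comp σ) ∘ (fun σ => (P.deck h).comp σ) := by
      funext σ
      ext t
      exact mul_smul _ _ _
    simp only [chainMap, Finsupp.lmapDomain_apply]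
    rw [this, Finsupp.mapDomain_comp]

/-- The complex `C_*(Ŷ, R̂)` of relative singular chains of the cover, as a complex of modules
over `ℤ[H]`. -/
def coverComplex (R : Set Y) : ModuleComplex.{u, v} (MonoidAlgebra ℤ (H1 Y)) where
  X n := (deckRep P R n).asModule
  d n := Representation.IntertwiningMap.equivLinearMapAsModule (deckRep P R (n + 1))
    (deckRep P R n)
    (((relComplex (P.lift R)).d n).intertwiningMap_of_isIntertwiningMap (deckRep P R (n + 1))
      (deckRep P R n) (by
      intro h x
      induction x using Submodule.Quotient.induction_on with | _ x
      show (Submodule.Quotient.mk (boundary _ n (chainMap (P.deck h) (n + 1) x)) :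
          RelChain (P.lift R) n) = Submodule.Quotient.mk (chainMap (P.deck h) n (boundary _ n x))
      rw [boundary_chainMap]))
  d_comp_d n x := (relComplex (P.lift R)).d_comp_d n x

end Covers

/-! ### Characters of the torsion subgroup and the coefficient rings -/

section Coefficients

variable {H : Type u} [CommGroup H]

/-- The torsion subgroup `T` of `H`. -/
abbrev Tors (H : Type u) [CommGroup H] : Subgroup H := CommGroup.torsion H

/-- The torsion-free quotient `G = H / T`. -/
abbrev Free (H : Type u) [CommGroup H] : Type u := H ⧸ Tors H

/-- A splitting `H ≅ T ⊕ G`: a homomorphism `s : H → T` which is the identity on `T`. -/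
structure Splitting (H : Type u) [CommGroup H] where
  toHom : H →* Tors H
  apply_torsion : ∀ t : Tors H, toHom t = t

/-- The field `F_χ`, generated over `ℚ` by the values of the character `χ`. -/
abbrev charField (χ : Tors H →* ℂˣ) : IntermediateField ℚ ℂ :=
  IntermediateField.adjoin ℚ (Set.range fun t => (χ t : ℂ))

/-- The character `χ`, with values in `F_χ`. -/
def charHom (χ : Tors H →* ℂˣ) : Tors H →* charField χ where
  toFun t := ⟨(χ t : ℂ), IntermediateField.subset_adjoin ℚ _ ⟨t, rfl⟩⟩
  map_one' := by ext; simp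
  map_mul' a b := by ext; simp

/-- Two characters are equivalent if `F_χ = F_χ'` and if they differ by a Galois automorphism
of this field over `ℚ`. -/
def CharEquiv (χ χ' : Tors H →* ℂˣ) : Prop :=
  charField χ = charField χ' ∧
    ∃ τ : charField χ ≃ₐ[ℚ] charField χ, ∀ t, ((τ (charHom χ t) : charField χ) : ℂ) = (χ' t : ℂ)

/-- `χ₁, …, χₘ` is a complete set of representatives for the characters of `T` modulo
equivalence. -/
structure IsCompleteSetOfChars {m : ℕ} (χ : Fin m → (Tors H →* ℂˣ)) : Prop where
  complete : ∀ χ' : Tors H →* ℂˣ, ∃ i, CharEquiv (χ i) χ'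
  inequivalent : ∀ i j, CharEquiv (χ i) (χ j) → i = j

/-- The ring homomorphism `ℚ[H] → F_χ[G]` with `h ↦ χ(s(h)) [h]`. -/
def charMap (s : Splitting H) (χ : Tors H →* ℂˣ) :
    MonoidAlgebra ℚ H →+* MonoidAlgebra (charField χ) (Free H) :=
  (MonoidAlgebra.lift ℚ (MonoidAlgebra (charField χ) (Free H)) H
    { toFun := fun h => MonoidAlgebra.single (h : Free H) (charHom χ (s.toHom h))
      map_one' := by simp [MonoidAlgebra.one_def]
      map_mul' := fun a b => by simp [MonoidAlgebra.single_mul_single] }).toRingHom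

/-- The inclusion `ℤ[H] → ℚ[H]`. -/
def intToRat (H : Type u) [CommGroup H] : MonoidAlgebra ℤ H →+* MonoidAlgebra ℚ H :=
  (MonoidAlgebra.lift ℤ (MonoidAlgebra ℚ H) H (MonoidAlgebra.of ℚ H)).toRingHom

end Coefficients

/-! ### Alexander functions -/

section AlexanderFunctions

/-- Let `M` be a module over `A`, given with an integer `d`. The function `f` on `⋀^d M` is
computed from an injective presentation matrix `N` of deficiency `d` for `M` (the generators being
mapped to `M` by `p`): its value at `u₁ ∧ ⋯ ∧ u_d` is the determinant of `[N | ū₁ ⋯ ū_d]`, where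
`ūₖ` is any expression of `uₖ` in the generators. -/
def IsComputedByPresentation {A : Type u} [CommRing A] {M : Type v} [AddCommGroup M] [Module A M]
    (d : ℤ) (f : (⋀[A]^(d.toNat) M) →ₗ[A] A) : Prop :=
  0 ≤ d ∧ ∃ (a : ℕ) (N : Matrix (Fin (a + d.toNat)) (Fin a) A)
    (p : (Fin (a + d.toNat) → A) →ₗ[A] M),
    Function.Surjective p ∧ LinearMap.ker p = LinearMap.range N.mulVecLin ∧
    Function.Injective N.mulVecLin ∧
    ∀ ubar : Fin d.toNat → (Fin (a + d.toNat) → A),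
      f (exteriorPower.ιMulti A d.toNat (fun k => p (ubar k))) =
        Matrix.det (Matrix.of fun i : Fin (a + d.toNat) =>
          Fin.addCases (fun j => N i j) (fun k => ubar k i))

variable {Y : Type u} [TopologicalSpace Y] (P : MaximalAbelianCover.{u, v} Y) (R : Set Y)

/-- `H_n(Y, R; ℚ[H])`. -/
abbrev HomologyQH (n : ℕ) : Type (max u v) :=
  TwistedHomology (coverComplex P R) (intToRat (H1 Y)) n

/-- `H_n(Y, R; F_χ[G])`, with respect to the splitting `s`. -/
abbrev HomologyFG (s : Splitting (H1 Y)) (χ : Tors (H1 Y) →* ℂˣ) (n : ℕ) : Type (max u v) :=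
  TwistedHomology (coverComplex P R) ((charMap s χ).comp (intToRat (H1 Y))) n

/-- `f` is (a representative of) the `F_χ[G]`-valued Alexander function of `(Y, R)`, with respect
to the splitting `s`. -/
def IsAlexanderFunctionFG (s : Splitting (H1 Y)) (χ : Tors (H1 Y) →* ℂˣ)
    (f : (⋀[MonoidAlgebra (charField χ) (Free (H1 Y))]^((deficiency R).toNat)
        (HomologyFG P R s χ 1)) →ₗ[MonoidAlgebra (charField χ) (Free (H1 Y))]
      MonoidAlgebra (charField χ) (Free (H1 Y))) : Prop :=
  (Nontrivial (HomologyFG P R s χ 2) → f = 0) ∧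
  (Subsingleton (HomologyFG P R s χ 2) → IsComputedByPresentation (deficiency R) f)

/-- `f` is (a representative of) the `ℚ[H]`-valued Alexander function of `(Y, R)`, assembled with
the splitting `s` from `F_χ[G]`-valued Alexander functions `g i` for the characters `χ = χ i`.
It is the composition of the isomorphism `⋀^d H_1(Y, R; ℚ[H]) ≅ ⨁ ⋀^d H_1(Y, R; F_χ[G])`, of
`⨁ g i`, and of the inverse of the isomorphism `ℚ[H] ≅ ⨁ F_χ[G]` given by the maps
`charMap s (χ i)`. -/
def IsAlexanderFunctionQH {m : ℕ} (χ : Fin m → (Tors (H1 Y) →* ℂˣ)) (s : Splitting (H1 Y))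
    (f : (⋀[MonoidAlgebra ℚ (H1 Y)]^((deficiency R).toNat) (HomologyQH P R 1))
      →ₗ[MonoidAlgebra ℚ (H1 Y)] MonoidAlgebra ℚ (H1 Y)) : Prop :=
  ∃ g : ∀ i, (⋀[MonoidAlgebra (charField (χ i)) (Free (H1 Y))]^((deficiency R).toNat)
        (HomologyFG P R s (χ i) 1)) →ₗ[MonoidAlgebra (charField (χ i)) (Free (H1 Y))]
      MonoidAlgebra (charField (χ i)) (Free (H1 Y)),
    (∀ i, IsAlexanderFunctionFG P R s (χ i) (g i)) ∧
    ∀ (i : Fin m) (u : Fin (deficiency R).toNat → HomologyQH P R 1),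
      charMap s (χ i) (f (exteriorPower.ιMulti _ _ u)) =
        g i (exteriorPower.ιMulti _ _ (fun k =>
          changeCoeff (coverComplex P R) (intToRat (H1 Y)) (charMap s (χ i)) 1 (u k)))

end AlexanderFunctions

end SuturedAlexander

end

open SuturedAlexander

/-! The argument is pure algebra and applies to any complex of modules in place of the chains of the
cover.

Two splittings agree on `T`, so their quotient descends to a homomorphism `G → T`. Composed with `χ`
it gives `κ : G → F_χ`, and `[g] ↦ κ(g)[g]` is an automorphism of `F_χ[G]` that turns `charMap s χ`
into `charMap s' χ` (`exists_charMap_eq_comp`). It induces a semilinear isomorphism of twisted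
homology, which carries presentation matrices to presentation matrices and commutes with
determinants. If the component functions for `s` are transported in this way, the decomposition of
`ℚ[H]` for `s'` absorbs the automorphism: the very same function on `⋀^d` is assembled from the
transported components (`IsAssembled.comp_equiv`). No unit is needed at this stage.

What remains is the choice of presentations for one splitting. Two injective presentations of equal
deficiency give determinants that differ by a unit of `F_χ[G]` (`exists_unit_det_eq`). The units for
the various `χ i` come from a single unit of `ℚ[H]`, because `ℚ[H] → ∏ F_χ[G]` is bijective:
injective (`charMap_injective`) since evaluations of characters at distinct elements of `T` are
linearly independent, surjective (`exists_charMap_eq`) by the Chinese remainder theorem for the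
maximal ideals `ker (ℚ[T] → F_χ)`. -/

namespace SuturedAlexander

/-! ### Determinants of injective presentation matrices -/

section Presentations

variable {A : Type*} [CommRing A] {M : Type*} [AddCommGroup M] [Module A M]

theorem transpose_mul_apply {m n k : Type*} [Fintype n] (N : Matrix m n A) (X : Matrix n k A)
    (j : k) : (N * X).transpose j = N.mulVec (X.transpose j) := rfl

theorem exists_mul_eq_of_ker_eq_range {n r k : Type*} [Fintype r] {N : Matrix n r A}
    {p : (n → A) →ₗ[A] M} (h : LinearMap.ker p = LinearMap.range N.mulVecLin) (W : Matrix n k A)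
    (hW : ∀ j, p (W.transpose j) = 0) : ∃ X : Matrix r k A, N * X = W := by
  have hW' (j : k) : ∃ x, N.mulVec x = W.transpose j := by
    have : W.transpose j ∈ LinearMap.ker p := hW j
    rw [h] at this
    exact this
  choose x hx using hW'
  refine ⟨(Matrix.of x).transpose, ?_⟩
  rw [← Matrix.transpose_inj]
  funext j
  rw [transpose_mul_apply]
  exact hx j

theorem map_mul_eq_zero {n r k : Type*} [Fintype r] {N : Matrix n r A}
    {p : (n → A) →ₗ[A] M} (h : LinearMap.ker p = LinearMap.range N.mulVecLin) (X : Matrix r k A)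
    (j : k) : p ((N * X).transpose j) = 0 := by
  rw [← LinearMap.mem_ker, h, transpose_mul_apply]
  exact ⟨_, rfl⟩

theorem map_mulVec_eq {n n' : Type*} [Fintype n'] [DecidableEq n'] {p : (n → A) →ₗ[A] M}
    {p' : (n' → A) →ₗ[A] M} {L : Matrix n n' A}
    (hL : ∀ j, p (L.transpose j) = p' (Pi.single j 1)) (v : n' → A) :
    p (L.mulVec v) = p' v := by
  have : p ∘ₗ L.mulVecLin = p' := by
    refine LinearMap.pi_ext' fun j => LinearMap.ext_ring ?_
    simpa [Matrix.col_def] using hL j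
  exact LinearMap.congr_fun this v

theorem exists_matrix_map_eq {n k : Type*} {p : (n → A) →ₗ[A] M}
    (hp : Function.Surjective p) (m : k → M) : ∃ L : Matrix n k A, ∀ j, p (L.transpose j) = m j := by
  choose x hx using fun j => hp (m j)
  exact ⟨(Matrix.of x).transpose, hx⟩

theorem eq_one_of_mul_eq_self {n k : Type*} [Fintype k] [DecidableEq k] {B : Matrix n k A}
    (hB : Function.Injective B.mulVec) {U : Matrix k k A} (h : B * U = B) : U = 1 := by
  rw [← Matrix.transpose_inj]
  funext j
  apply hB
  rw [← transpose_mul_apply, ← transpose_mul_apply, h, Matrix.mul_one]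

/-- Moving the second summand to the end. -/
def sumShuffle (a b c : Type*) : (a ⊕ c) ⊕ b ≃ (a ⊕ b) ⊕ c where
  toFun := Sum.elim (Sum.elim (fun x => Sum.inl (Sum.inl x)) Sum.inr)
    fun y => Sum.inl (Sum.inr y)
  invFun := Sum.elim (Sum.elim (fun x => Sum.inl (Sum.inl x)) Sum.inr)
    fun y => Sum.inl (Sum.inr y)
  left_inv := by rintro ((_ | _) | _) <;> rfl
  right_inv := by rintro ((_ | _) | _) <;> rfl

/-- Two injective presentation matrices of the same deficiency, for the same module, give the same
determinants up to a unit. -/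
theorem exists_unit_det_eq {r r' δ : Type*} [Fintype r] [Fintype r'] [Fintype δ] [DecidableEq r]
    [DecidableEq r'] [DecidableEq δ] {N : Matrix (r ⊕ δ) r A} {N' : Matrix (r' ⊕ δ) r' A}
    {p : (r ⊕ δ → A) →ₗ[A] M} {p' : (r' ⊕ δ → A) →ₗ[A] M}
    (hp : Function.Surjective p) (hp' : Function.Surjective p')
    (hk : LinearMap.ker p = LinearMap.range N.mulVecLin)
    (hk' : LinearMap.ker p' = LinearMap.range N'.mulVecLin)
    (hN : Function.Injective N.mulVec) :
    ∃ c : Aˣ, ∀ (V : Matrix (r ⊕ δ) δ A) (V' : Matrix (r' ⊕ δ) δ A),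
      (∀ j, p (V.transpose j) = p' (V'.transpose j)) →
      (Matrix.fromCols N' V').det = c * (Matrix.fromCols N V).det := by
  -- `L` and `L'` express the generators of each presentation in those of the other: `p ∘ L = p'`
  -- and `p' ∘ L' = p`. Then `L * N'`, `L' * N`, `1 - L * L'` and `1 - L' * L` have their columns
  -- among the relations, hence factor through `N` or `N'`.
  obtain ⟨L, hL⟩ := exists_matrix_map_eq hp fun j => p' (Pi.single j 1)
  obtain ⟨L', hL'⟩ := exists_matrix_map_eq hp' fun j => p (Pi.single j 1)
  obtain ⟨X, hX⟩ := exists_mul_eq_of_ker_eq_range hk (L * N') fun j => by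
    rw [transpose_mul_apply, map_mulVec_eq hL]
    simpa using map_mul_eq_zero hk' 1 j
  obtain ⟨X', hX'⟩ := exists_mul_eq_of_ker_eq_range hk' (L' * N) fun j => by
    rw [transpose_mul_apply, map_mulVec_eq hL']
    simpa using map_mul_eq_zero hk 1 j
  obtain ⟨Z, hZ⟩ := exists_mul_eq_of_ker_eq_range hk (1 - L * L') fun j => by
    rw [Matrix.transpose_sub, Matrix.transpose_one]
    change p ((1 : Matrix _ _ A) j - (L * L').transpose j) = 0
    rw [map_sub, transpose_mul_apply, map_mulVec_eq hL, hL', sub_eq_zero]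
    congr 1
    funext i
    simp [Matrix.one_apply, Pi.single_apply, eq_comm]
  obtain ⟨Z', hZ'⟩ := exists_mul_eq_of_ker_eq_range hk' (1 - L' * L) fun j => by
    rw [Matrix.transpose_sub, Matrix.transpose_one]
    change p' ((1 : Matrix _ _ A) j - (L' * L).transpose j) = 0
    rw [map_sub, transpose_mul_apply, map_mulVec_eq hL', hL, sub_eq_zero]
    congr 1
    funext i
    simp [Matrix.one_apply, Pi.single_apply, eq_comm]
  -- The columns of `B` and those of `B'` both lie in the kernel of `(p, p')` on the sum of the two
  -- free modules; `U` and `U'` are the changes between these two systems of relations.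
  let B : Matrix ((r ⊕ δ) ⊕ (r' ⊕ δ)) (r ⊕ (r' ⊕ δ)) A := Matrix.fromBlocks N (-L) 0 1
  let B' : Matrix ((r ⊕ δ) ⊕ (r' ⊕ δ)) (r' ⊕ (r ⊕ δ)) A := Matrix.fromBlocks 0 1 N' (-L')
  let U : Matrix (r ⊕ (r' ⊕ δ)) (r' ⊕ (r ⊕ δ)) A := Matrix.fromBlocks X Z N' (-L')
  let U' : Matrix (r' ⊕ (r ⊕ δ)) (r ⊕ (r' ⊕ δ)) A := Matrix.fromBlocks X' Z' N (-L)
  have hBU : B * U = B' := by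
    simp [B, U, B', Matrix.fromBlocks_multiply, hX, hZ]
  have hBU' : B' * U' = B := by
    simp [B, U', B', Matrix.fromBlocks_multiply, hX', hZ']
  have hB : Function.Injective B.mulVec := by
    intro x y h
    have h1 (i) := congrFun h (Sum.inr i)
    have h2 (i) := congrFun h (Sum.inl i)
    simp only [B, Matrix.fromBlocks_mulVec, Sum.elim_inl, Sum.elim_inr, Matrix.zero_mulVec,
      Matrix.one_mulVec, zero_add] at h1 h2
    have h3 : x ∘ Sum.inr = y ∘ Sum.inr := funext h1
    rw [h3] at h2
    have h4 : x ∘ Sum.inl = y ∘ Sum.inl := hN (funext fun i => add_right_cancel (h2 i))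
    rw [← Sum.elim_comp_inl_inr x, ← Sum.elim_comp_inl_inr y, h3, h4]
  -- A one-sided inverse is enough, since only the determinant of `U` has to be invertible.
  have hUU' : U * U' = 1 := eq_one_of_mul_eq_self hB (by rw [← Matrix.mul_assoc, hBU, hBU'])
  -- The row and column types differ, so determinants need identifications of them. Two such
  -- identifications occur; they differ by the permutation `π`, which contributes only a sign.
  let e : r' ⊕ (r ⊕ δ) ≃ r ⊕ (r' ⊕ δ) :=
    ((Equiv.sumAssoc r' r δ).symm.trans ((Equiv.sumComm r' r).sumCongr (Equiv.refl δ))).trans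
      (Equiv.sumAssoc r r' δ)
  let σ := Equiv.sumComm (r' ⊕ δ) (r ⊕ δ)
  let c := sumShuffle r (r' ⊕ δ) δ
  let c' := sumShuffle r' (r ⊕ δ) δ
  let e₁ := c'.trans (e.sumCongr (Equiv.refl δ))
  let π : Equiv.Perm ((r' ⊕ δ) ⊕ (r ⊕ δ)) := e₁.trans (σ.trans c).symm
  have hunit : IsUnit (U.submatrix e id).det := by
    refine IsUnit.of_mul_eq_one (U'.submatrix id e).det ?_
    rw [← Matrix.det_mul, ← Matrix.submatrix_mul _ _ _ _ _ Function.bijective_id, hUU',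
      Matrix.submatrix_one _ e.injective, Matrix.det_one]
  refine ⟨Units.map (Int.castRingHom A : ℤ →* A) (Equiv.Perm.sign π) * hunit.unit,
    fun V V' hV => ?_⟩
  -- As `V` and `V'` have the same images in `M`, the columns `(-V, V')` lie in the kernel of `(p,
  -- p')`; they equal `B` times `(w, V')`. Hence `E` and `E'` differ by the block triangular `Q`,
  -- whose determinant does not involve `V` or `V'`.
  obtain ⟨w, hw⟩ := exists_mul_eq_of_ker_eq_range hk (L * V' - V) fun j => by
    rw [Matrix.transpose_sub]
    change p ((L * V').transpose j - V.transpose j) = 0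
    rw [map_sub, transpose_mul_apply, map_mulVec_eq hL, hV, sub_self]
  let E := Matrix.fromCols B (Matrix.fromRows V 0)
  let E' := Matrix.fromCols B' (Matrix.fromRows 0 V')
  let Q : Matrix ((r ⊕ (r' ⊕ δ)) ⊕ δ) ((r' ⊕ (r ⊕ δ)) ⊕ δ) A :=
    Matrix.fromBlocks U (Matrix.fromRows w V') 0 1
  have hBw : B * Matrix.fromRows w V' + Matrix.fromRows V 0 = Matrix.fromRows 0 V' := by
    have : B = Matrix.fromRows (Matrix.fromCols N (-L)) (Matrix.fromCols 0 1) := by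
      simp [B]
    rw [this, Matrix.fromRows_mul, Matrix.fromCols_mul_fromRows, Matrix.fromCols_mul_fromRows, hw]
    ext (i | i) j
    · simp only [Matrix.add_apply, Matrix.fromRows_apply_inl, Matrix.neg_mul, Matrix.neg_apply,
        Matrix.sub_apply, Matrix.zero_apply]
      ring
    · simp
  have hEQ : E * Q = E' := by
    simp [E, Q, E', Matrix.fromCols_mul_fromBlocks, hBU, hBw]
  have hE : (E.submatrix id c).det = (Matrix.fromCols N V).det := by
    have : E.submatrix id c = Matrix.fromBlocks (Matrix.fromCols N V) (-L) 0 1 := by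
      ext (i | i) ((j | j) | j) <;> rfl
    rw [this, Matrix.det_fromBlocks_zero₂₁, Matrix.det_one, mul_one]
  have hE' : (E'.submatrix σ c').det = (Matrix.fromCols N' V').det := by
    have : E'.submatrix σ c' = Matrix.fromBlocks (Matrix.fromCols N' V') (-L') 0 1 := by
      ext (i | i) ((j | j) | j) <;> rfl
    rw [this, Matrix.det_fromBlocks_zero₂₁, Matrix.det_one, mul_one]
  have hE₁ : (E.submatrix σ e₁).det = (Equiv.Perm.sign π : ℤ) * (Matrix.fromCols N V).det := by
    have : E.submatrix σ e₁ = ((E.submatrix id c).submatrix σ σ).submatrix id π := by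
      ext i j
      simp [π]
    rw [this, Matrix.det_permute', Matrix.det_submatrix_equiv_self, hE]
  have hQ : (Q.submatrix e₁ c').det = (U.submatrix e id).det := by
    have h1 : Q.submatrix e₁ c' = (Q.submatrix (e.sumCongr (Equiv.refl δ)) id).submatrix c' c' := rfl
    have h2 : Q.submatrix (e.sumCongr (Equiv.refl δ)) id =
        Matrix.fromBlocks (U.submatrix e id) ((Matrix.fromRows w V').submatrix e id) 0 1 := by
      ext (i | i) (j | j) <;> rfl
    rw [h1, Matrix.det_submatrix_equiv_self, h2, Matrix.det_fromBlocks_zero₂₁, Matrix.det_one,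
      mul_one]
  rw [← hE', ← hEQ, Matrix.submatrix_mul _ _ _ _ _ e₁.bijective, Matrix.det_mul, hE₁, hQ]
  simp only [Units.val_mul, Units.coe_map, IsUnit.unit_spec]
  change _ = (((Equiv.Perm.sign π : ℤˣ) : ℤ) : A) * _ * _
  ring

theorem det_of_addCases {a d : ℕ} (N : Matrix (Fin (a + d)) (Fin a) A)
    (v : Fin d → Fin (a + d) → A) :
    Matrix.det (Matrix.of fun i : Fin (a + d) => Fin.addCases (fun j => N i j) (fun k => v k i)) =
      (Matrix.fromCols (N.submatrix finSumFinEquiv id)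
        ((Matrix.of v).transpose.submatrix finSumFinEquiv id)).det := by
  rw [← Matrix.det_submatrix_equiv_self finSumFinEquiv]
  congr 1
  ext i (j | j) <;> simp

/-- A linear map on `⋀^d M` is determined by its values on decomposable elements, and there
`exists_unit_det_eq` supplies one unit for all choices of lifts. The rest is reindexing `Fin (a +
d)` as a sum type. -/
theorem IsComputedByPresentation.exists_unit {d : ℤ} {f f' : (⋀[A]^(d.toNat) M) →ₗ[A] A}
    (hf : IsComputedByPresentation d f) (hf' : IsComputedByPresentation d f') :
    ∃ c : Aˣ, f' = (c : A) • f := by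
  obtain ⟨-, a, N, p, hp, hk, hN, h⟩ := hf
  obtain ⟨-, a', N', p', hp', hk', hN', h'⟩ := hf'
  have key (b : ℕ) (N : Matrix (Fin (b + d.toNat)) (Fin b) A) (p : (Fin (b + d.toNat) → A) →ₗ[A] M)
      (hp : Function.Surjective p) (hk : LinearMap.ker p = LinearMap.range N.mulVecLin)
      (hN : Function.Injective N.mulVecLin) :
      let q := p ∘ₗ (LinearEquiv.funCongrLeft A A finSumFinEquiv.symm).toLinearMap
      let K := N.submatrix (finSumFinEquiv (m := b) (n := d.toNat)) id
      Function.Surjective q ∧ LinearMap.ker q = LinearMap.range K.mulVecLin ∧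
        Function.Injective K.mulVec := by
    intro q K
    have hKN (x) : K.mulVec x = N.mulVec x ∘ finSumFinEquiv := rfl
    refine ⟨hp.comp (LinearEquiv.surjective _), ?_, fun x y hxy => hN ?_⟩
    · ext x
      have : x ∈ LinearMap.ker q ↔ (x ∘ finSumFinEquiv.symm) ∈ LinearMap.ker p := Iff.rfl
      rw [this, hk]
      refine exists_congr fun y => ?_
      change N.mulVec y = _ ↔ K.mulVec y = x
      rw [hKN, Equiv.eq_comp_symm]
    · exact (Equiv.surjective finSumFinEquiv).injective_comp_right hxy
  obtain ⟨hq, hqk, hqN⟩ := key a N p hp hk hN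
  obtain ⟨hq', hqk', -⟩ := key a' N' p' hp' hk' hN'
  obtain ⟨c, hc⟩ := exists_unit_det_eq hq hq' hqk hqk' hqN
  refine ⟨c, exteriorPower.linearMap_ext (AlternatingMap.ext fun u => ?_)⟩
  choose v hv using fun k => hp (u k)
  choose v' hv' using fun k => hp' (u k)
  simp only [LinearMap.compAlternatingMap_apply, LinearMap.smul_apply, smul_eq_mul]
  have e1 := h v
  have e2 := h' v'
  simp only [hv, hv'] at e1 e2
  rw [e1, e2, det_of_addCases, det_of_addCases]
  refine hc _ _ fun j => ?_
  have t1 : p (v j) = p' (v' j) := by rw [hv, hv']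
  have e3 (b : ℕ) (x : Fin (b + d.toNat) → A) :
      LinearEquiv.funCongrLeft A A finSumFinEquiv.symm (x ∘ finSumFinEquiv) = x :=
    funext fun i => congrArg x (finSumFinEquiv.apply_symm_apply i)
  exact (congrArg p (e3 _ _)).trans (t1.trans (congrArg p' (e3 _ _)).symm)

end Presentations
-- Transport along semilinear isomorphisms
section Semilinear

variable {A : Type*} [CommRing A] {M M' : Type*} [AddCommGroup M] [Module A M]
  [AddCommGroup M'] [Module A M'] (α : A ≃+* A) (θ : M ≃+ M')

theorem symm_map_smul_of_semilinear {α : A ≃+* A} {θ : M ≃+ M'}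
    (hθ : ∀ a x, θ (a • x) = α a • θ x) (a : A) (x : M') :
    θ.symm (a • x) = α.symm a • θ.symm x := by
  rw [AddEquiv.symm_apply_eq, hθ, RingEquiv.apply_symm_apply, AddEquiv.apply_symm_apply]

/-- The transport of a function on an exterior power along an isomorphism of modules that is
semilinear over a ring automorphism. -/
theorem exists_exteriorPower_transport {n : ℕ} {α : A ≃+* A} {θ : M ≃+ M'}
    (hθ : ∀ a x, θ (a • x) = α a • θ x) (f : (⋀[A]^n M) →ₗ[A] A) :
    ∃ f' : (⋀[A]^n M') →ₗ[A] A, ∀ u : Fin n → M',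
      f' (exteriorPower.ιMulti A n u) = α (f (exteriorPower.ιMulti A n fun k => θ.symm (u k))) := by
  let F := exteriorPower.alternatingMapLinearEquiv.symm f
  have hF (u : Fin n → M) : F u = f (exteriorPower.ιMulti A n u) := rfl
  have hup [DecidableEq (Fin n)] (u : Fin n → M') (i : Fin n) (x : M') :
      (fun k => θ.symm (Function.update u i x k)) =
        Function.update (fun k => θ.symm (u k)) i (θ.symm x) :=
    funext fun k => Function.apply_update (fun _ => θ.symm) u i x k
  -- Each scalar leaves `θ.symm` as `α.symm a` and the outer `α` turns it back into `a`, so the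
  -- conjugate is linear and not merely semilinear.
  let F' : M' [⋀^Fin n]→ₗ[A] A :=
    { toFun := fun u => α (F fun k => θ.symm (u k))
      map_update_add' := by
        intro _ u i x y
        simp only [hup, map_add, F.map_update_add]
      map_update_smul' := by
        intro _ u i a x
        simp only [hup, symm_map_smul_of_semilinear hθ, F.map_update_smul, smul_eq_mul, map_mul,
          RingEquiv.apply_symm_apply]
      map_eq_zero_of_eq' := by
        intro u i j h hij
        rw [F.map_eq_zero_of_eq _ (congrArg θ.symm h) hij, map_zero] }
  refine ⟨exteriorPower.alternatingMapLinearEquiv F', fun u => ?_⟩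
  rw [exteriorPower.alternatingMapLinearEquiv_apply_ιMulti]
  rfl

theorem comp_symm_comp (α : A ≃+* A) {n : Type*} (x : n → A) : α ∘ α.symm ∘ x = x :=
  funext fun i => α.apply_symm_apply (x i)

theorem symm_comp_comp (α : A ≃+* A) {n : Type*} (x : n → A) : α.symm ∘ α ∘ x = x :=
  funext fun i => α.symm_apply_apply (x i)

/-- Apply `α` to the entries of the presentation matrix and use `θ ∘ p ∘ α⁻¹` on the generators. The
two semilinearities cancel, and determinants commute with ring homomorphisms. -/
theorem IsComputedByPresentation.transport {d : ℤ} {α : A ≃+* A} {θ : M ≃+ M'}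
    (hθ : ∀ a x, θ (a • x) = α a • θ x) {f : (⋀[A]^(d.toNat) M) →ₗ[A] A}
    {f' : (⋀[A]^(d.toNat) M') →ₗ[A] A}
    (hf' : ∀ u : Fin d.toNat → M', f' (exteriorPower.ιMulti A _ u) =
      α (f (exteriorPower.ιMulti A _ fun k => θ.symm (u k))))
    (hf : IsComputedByPresentation d f) : IsComputedByPresentation d f' := by
  obtain ⟨hd, a, N, p, hp, hk, hN, h⟩ := hf
  have hmap (x : Fin a → A) : (N.map α).mulVec (α ∘ x) = α ∘ N.mulVec x :=
    funext fun i => (RingHom.map_mulVec (α : A →+* A) N x i).symm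
  have hmap' (x : Fin a → A) : (N.map α).mulVec x = α ∘ N.mulVec (α.symm ∘ x) := by
    rw [← hmap, comp_symm_comp]
  refine ⟨hd, a, N.map α,
    { toFun := fun x => θ (p (α.symm ∘ x))
      map_add' := fun x y => by
        rw [← map_add, ← map_add]
        congr 2
        funext i
        simp
      map_smul' := fun c x => by
        have : α.symm ∘ (c • x) = α.symm c • (α.symm ∘ x) := by
          funext i
          simp
        rw [this, map_smul, hθ, RingEquiv.apply_symm_apply]
        rfl }, ?_, ?_, ?_, ?_⟩
  · intro y
    obtain ⟨x, hx⟩ := hp (θ.symm y)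
    refine ⟨α ∘ x, ?_⟩
    change θ (p (α.symm ∘ α ∘ x)) = y
    rw [symm_comp_comp, hx, AddEquiv.apply_symm_apply]
  · ext x
    have : θ (p (α.symm ∘ x)) = 0 ↔ (α.symm ∘ x) ∈ LinearMap.ker p :=
      EmbeddingLike.map_eq_zero_iff (f := θ)
    refine Iff.trans ?_ (this.trans ?_)
    · exact Iff.rfl
    rw [hk]
    constructor
    · rintro ⟨y, hy⟩
      refine ⟨α ∘ y, ?_⟩
      change (N.map α).mulVec (α ∘ y) = x
      rw [hmap]
      change α ∘ (N.mulVecLin y) = x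
      rw [hy, comp_symm_comp]
    · rintro ⟨y, rfl⟩
      refine ⟨α.symm ∘ y, ?_⟩
      change N.mulVec (α.symm ∘ y) = α.symm ∘ (N.map α).mulVec y
      rw [hmap', symm_comp_comp]
  · intro x y hxy
    change (N.map α).mulVec x = (N.map α).mulVec y at hxy
    rw [hmap', hmap'] at hxy
    exact α.symm.injective.comp_left (hN (α.injective.comp_left hxy))
  · intro v
    rw [hf']
    change α (f (exteriorPower.ιMulti A _ fun k => θ.symm (θ (p (α.symm ∘ v k))))) = _
    simp only [AddEquiv.symm_apply_apply]
    rw [h, RingEquiv.map_det]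
    congr 1
    ext i j
    refine Fin.addCases (fun j => ?_) (fun k => ?_) j <;> simp

end Semilinear

/-! ### Twisted homology under isomorphisms of coefficient rings -/

section ChangeOfCoefficients

universe u v w

variable {R : Type u} [CommRing R] (C : ModuleComplex.{u, v} R) {A B : Type w} [CommRing A]
  [CommRing B]

theorem changeCoeffChain_bijective (φ : R →+* A) (ψ : A →+* B) (hψ : Function.Bijective ψ)
    (n : ℕ) : Function.Bijective (changeCoeffChain C φ ψ n) := by
  let e : Coeff φ ≃ₗ[R] Coeff (ψ.comp φ) := LinearEquiv.ofBijective (coeffLinear φ ψ) hψ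
  exact (e.rTensor (C.X n)).bijective

theorem changeCoeff_bijective (φ : R →+* A) (ψ : A →+* B) (hψ : Function.Bijective ψ)
    (n : ℕ) : Function.Bijective (changeCoeff C φ ψ n) := by
  have hb := changeCoeffChain_bijective C φ ψ hψ
  constructor
  · refine (injective_iff_map_eq_zero (Submodule.mapQ _ _ _ _ : _ →ₛₗ[coeffHom φ ψ] _)).2 ?_
    intro x hx
    induction x using Submodule.Quotient.induction_on with | _ x
    rw [Submodule.mapQ_apply, Submodule.Quotient.mk_eq_zero] at hx
    obtain ⟨y', hy'⟩ := hx
    obtain ⟨y, rfl⟩ := (hb (n + 1)).2 y'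
    rw [changeCoeffChain_d] at hy'
    rw [Submodule.Quotient.mk_eq_zero]
    exact ⟨y, (hb n).1 hy'⟩
  · intro y
    induction y using Submodule.Quotient.induction_on with | _ y
    obtain ⟨y, hy⟩ := y
    obtain ⟨x, rfl⟩ := (hb n).2 y
    have hx : x ∈ (C.tensor φ).cycles n := by
      cases n with
      | zero => trivial
      | succ n =>
        refine (hb n).1 ?_
        rw [← changeCoeffChain_d, map_zero]
        exact hy
    exact ⟨Submodule.Quotient.mk ⟨x, hx⟩, rfl⟩

theorem changeCoeff_smul (φ : R →+* A) (ψ : A →+* B) (n : ℕ) (a : A)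
    (x : TwistedHomology C φ n) :
    changeCoeff C φ ψ n (a • x) = ψ a • changeCoeff C φ ψ n x := by
  induction x using Submodule.Quotient.induction_on with | _ x
  exact congrArg Submodule.Quotient.mk
    (Subtype.ext (map_smulₛₗ (changeCoeffChain C φ ψ n) (show Coeff φ from a) x.1))

theorem changeCoeff_add (φ : R →+* A) (ψ : A →+* B) (n : ℕ) (x y : TwistedHomology C φ n) :
    changeCoeff C φ ψ n (x + y) = changeCoeff C φ ψ n x + changeCoeff C φ ψ n y :=
  map_add (Submodule.mapQ _ _ _ _) x y

theorem exists_twistedHomology_equiv (φ : R →+* A) {ψ ψ' : A →+* B} (α : B ≃+* B)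
    (h : ψ' = (α : B →+* B).comp ψ) (n : ℕ) :
    ∃ θ : TwistedHomology C (ψ.comp φ) n ≃+ TwistedHomology C (ψ'.comp φ) n,
      (∀ (b : B) x, θ (b • x) = α b • θ x) ∧
      ∀ x, θ (changeCoeff C φ ψ n x) = changeCoeff C φ ψ' n x := by
  -- With `ψ'` literally a composite, associativity of composition is definitional, so `changeCoeff`
  -- along `α` already lands in the required module.
  subst h
  refine ⟨AddEquiv.ofBijective (AddMonoidHom.mk' (changeCoeff C (ψ.comp φ) (α : B →+* B) n)
      (changeCoeff_add C (ψ.comp φ) (α : B →+* B) n))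
    (changeCoeff_bijective C (ψ.comp φ) (α : B →+* B) α.bijective n), ?_, ?_⟩
  · intro b x
    exact changeCoeff_smul C (ψ.comp φ) (α : B →+* B) n b x
  · intro x
    induction x using Submodule.Quotient.induction_on with | _ x
    obtain ⟨x, hx⟩ := x
    have key : changeCoeffChain C (ψ.comp φ) (α : B →+* B) n (changeCoeffChain C φ ψ n x) =
        changeCoeffChain C φ ((α : B →+* B).comp ψ) n x := by
      clear hx
      change Coeff φ ⊗[R] C.X n at x
      induction x using TensorProduct.induction_on with
      | zero => exact (congrArg _ (map_zero _)).trans ((map_zero _).trans (map_zero _).symm)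
      | tmul b m => rfl
      | add x y hx hy =>
        exact ((congrArg _ (map_add _ x y)).trans (map_add _ _ _)).trans
          ((congrArg₂ (· + ·) hx hy).trans (map_add _ x y).symm)
    exact congrArg Submodule.Quotient.mk (Subtype.ext key)

end ChangeOfCoefficients
-- Comparison of two splittings
section Twist

/-- The endomorphism `[g] ↦ κ(g) [g]` of a group algebra. -/
noncomputable def twist {K G : Type*} [CommRing K] [CommGroup G] (κ : G →* K) :
    MonoidAlgebra K G →ₐ[K] MonoidAlgebra K G :=
  MonoidAlgebra.lift K (MonoidAlgebra K G) G
    { toFun := fun g => MonoidAlgebra.single g (κ g)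
      map_one' := by simp [MonoidAlgebra.one_def]
      map_mul' := fun a b => by simp [MonoidAlgebra.single_mul_single] }

theorem twist_single {K G : Type*} [CommRing K] [CommGroup G] (κ : G →* K) (g : G) (a : K) :
    twist κ (MonoidAlgebra.single g a) = MonoidAlgebra.single g (a * κ g) := by
  simp [twist, MonoidAlgebra.lift_single, MonoidAlgebra.smul_single]

theorem twist_comp_twist {K G : Type*} [CommRing K] [CommGroup G] {κ κ' : G →* K}
    (h : ∀ g, κ g * κ' g = 1) : (twist κ').comp (twist κ) = AlgHom.id K _ := by
  ext g
  simp [twist_single, h]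

/-- `twist κ` as an automorphism, with inverse `twist κ'`. -/
noncomputable def twistEquiv {K G : Type*} [CommRing K] [CommGroup G] {κ κ' : G →* K}
    (h : ∀ g, κ g * κ' g = 1) : MonoidAlgebra K G ≃ₐ[K] MonoidAlgebra K G :=
  AlgEquiv.ofAlgHom (twist κ) (twist κ')
    (twist_comp_twist fun g => by rw [mul_comm, h]) (twist_comp_twist h)

variable {H : Type*} [CommGroup H]

theorem charMap_single (s : Splitting H) (χ : Tors H →* ℂˣ) (h : H) (a : ℚ) :
    charMap s χ (MonoidAlgebra.single h a) =
      MonoidAlgebra.single (h : Free H) (a • charHom χ (s.toHom h)) := by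
  simp [charMap, MonoidAlgebra.lift_single, MonoidAlgebra.smul_single]

theorem Splitting.apply_mem (s : Splitting H) {h : H} (hh : h ∈ Tors H) :
    s.toHom h = ⟨h, hh⟩ := s.apply_torsion ⟨h, hh⟩

/-- The quotient of two splittings, as a homomorphism on the free part. -/
def Splitting.quotient (s s' : Splitting H) : Free H →* Tors H :=
  QuotientGroup.lift (Tors H) (s'.toHom * s.toHom⁻¹) fun h hh => by
    simp [s.apply_mem hh, s'.apply_mem hh]

theorem Splitting.quotient_mk (s s' : Splitting H) (h : H) :
    s.quotient s' (h : Free H) = s'.toHom h * (s.toHom h)⁻¹ := rfl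

/-- The automorphism is the twist by `χ ∘ (s'/s)`; its inverse is the twist by the inverse
homomorphism. On `[h]` the factor `s'(h) s(h)⁻¹` replaces `s(h)` by `s'(h)`. -/
theorem exists_charMap_eq_comp (s s' : Splitting H) (χ : Tors H →* ℂˣ) :
    ∃ α : MonoidAlgebra (charField χ) (Free H) ≃+* MonoidAlgebra (charField χ) (Free H),
      charMap s' χ = (α : _ →+* _).comp (charMap s χ) := by
  have h (g : Free H) : (charHom χ).comp (s.quotient s') g *
      (charHom χ).comp (s.quotient s')⁻¹ g = 1 := by
    rw [MonoidHom.comp_apply, MonoidHom.comp_apply, ← map_mul, MonoidHom.inv_apply,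
      mul_inv_cancel, map_one]
  refine ⟨(twistEquiv h).toRingEquiv, ?_⟩
  refine MonoidAlgebra.ringHom_ext (fun a => ?_) (fun g => ?_)
  · change charMap s' χ _ = twist _ (charMap s χ _)
    simp [charMap_single, twist_single]
  · change charMap s' χ _ = twist _ (charMap s χ _)
    rw [charMap_single, charMap_single, twist_single, one_smul, one_smul]
    congr 1
    rw [MonoidHom.comp_apply, s.quotient_mk, ← map_mul, mul_comm, inv_mul_cancel_right]

end Twist

/-! ### Complex characters of a commutative group -/

section Characters

/-- The map is `q ↦ exp(2πiq)`, whose kernel on `ℚ` is `ℤ`. It turns `ℚ/ℤ`-valued characters, which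
are known to separate points, into complex ones. -/
theorem exists_rat_circle_hom : ∃ f : AddCircle (1 : ℚ) →+ Additive ℂˣ, Function.Injective f := by
  let g : ℚ →+ Additive ℂˣ := AddMonoidHom.mk'
    (fun q => Additive.ofMul (Units.mk0 (Complex.exp (2 * Real.pi * Complex.I * q))
      (Complex.exp_ne_zero _)))
    (fun a b => by
      apply Additive.toMul.injective
      ext
      simp [mul_add, Complex.exp_add])
  have hg (q : ℚ) : g q = 0 ↔ q ∈ AddSubgroup.zmultiples (1 : ℚ) := by
    have h1 : g q = 0 ↔ Complex.exp (2 * Real.pi * Complex.I * q) = 1 := by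
      rw [← Additive.toMul.injective.eq_iff, ← Units.val_inj]
      rfl
    rw [h1, Complex.exp_eq_one_iff, AddSubgroup.mem_zmultiples_iff]
    refine exists_congr fun n => ?_
    rw [mul_comm, mul_left_inj' Complex.two_pi_I_ne_zero, zsmul_one, eq_comm]
    exact_mod_cast Iff.rfl
  refine ⟨QuotientAddGroup.lift _ g fun q hq => (hg q).2 hq, ?_⟩
  rw [injective_iff_map_eq_zero]
  intro x hx
  induction x using QuotientAddGroup.induction_on with | _ q
  exact (QuotientAddGroup.eq_zero_iff q).2 ((hg q).1 hx)

/-- Complex characters separate the elements of a commutative group. -/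
theorem exists_char_ne_one {T : Type*} [CommGroup T] {t : T} (ht : t ≠ 1) :
    ∃ χ : T →* ℂˣ, χ t ≠ 1 := by
  obtain ⟨c, hc⟩ := CharacterModule.exists_character_apply_ne_zero_of_ne_zero
    (A := Additive T) (a := Additive.ofMul t) ht
  obtain ⟨f, hf⟩ := exists_rat_circle_hom
  let χ : Additive T →+ Additive ℂˣ := f.comp c
  refine ⟨MonoidHom.toAdditive.symm χ, fun h => hc (hf ?_)⟩
  rw [map_zero]
  exact h

/-- The evaluations of the complex characters at the elements of `T` are linearly independent. -/
theorem linearIndependent_eval_char (T : Type*) [CommGroup T] :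
    LinearIndependent ℂ (fun (t : T) (χ : T →* ℂˣ) => (χ t : ℂ)) := by
  -- Dedekind's independence theorem is applied to the monoid of characters: evaluations are
  -- homomorphisms on it, and they are distinct because characters separate points.
  let ev (t : T) : (T →* ℂˣ) →* ℂ := (Units.coeHom ℂ).comp (MonoidHom.eval t)
  have hev : Function.Injective ev := by
    intro a b h
    by_contra hab
    obtain ⟨χ, hχ⟩ := exists_char_ne_one (t := a * b⁻¹) (by rwa [Ne, mul_inv_eq_one])
    refine hχ ?_
    have : χ a = χ b := Units.ext (DFunLike.congr_fun h χ)
    rw [map_mul, map_inv, this, mul_inv_cancel]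
  exact (linearIndependent_monoidHom (T →* ℂˣ) ℂ).comp ev hev

end Characters

/-! ### The isomorphism of `ℚ[H]` with the product of the `F_χ[G]` -/

section Decomposition

variable {H : Type*} [CommGroup H]

/-- Lets a rational relation among values of a representative pass to every equivalent character. -/
theorem CharEquiv.map_eq {χ χ' : Tors H →* ℂˣ} (h : CharEquiv χ χ') :
    ∃ τ : charField χ →+* ℂ, ∀ t, τ (charHom χ t) = χ' t := by
  obtain ⟨-, τ, hτ⟩ := h
  exact ⟨(algebraMap (charField χ) ℂ).comp (τ : charField χ →+* charField χ), hτ⟩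

theorem coeff_charMap (s : Splitting H) (χ : Tors H →* ℂˣ) (x : MonoidAlgebra ℚ H) (g : Free H) :
    (charMap s χ x).coeff g = open Classical in
      ∑ h ∈ x.coeff.support with (QuotientGroup.mk h : Free H) = g, x.coeff h • charHom χ (s.toHom h) := by
  classical
  have : charMap s χ x = ∑ h ∈ x.coeff.support,
      MonoidAlgebra.single (h : Free H) (x.coeff h • charHom χ (s.toHom h)) := by
    simp only [← charMap_single, ← map_sum]
    congr 1
    exact (MonoidAlgebra.sum_coeff_single x).symm
  rw [this, Finset.sum_filter, MonoidAlgebra.coeff_sum, Finsupp.finsetSum_apply]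
  simp [Finsupp.single_apply]

/-- Two elements of a coset of `T` differ by a torsion element, which `s` fixes. -/
theorem Splitting.injOn_fiber (s : Splitting H) (g : Free H) :
    Set.InjOn s.toHom {h : H | (h : Free H) = g} := by
  intro a ha b hb hab
  have hmem : a⁻¹ * b ∈ Tors H := QuotientGroup.eq.1 (ha.trans hb.symm)
  have h1 := s.apply_mem hmem
  rw [map_mul, map_inv, hab, inv_mul_cancel] at h1
  have h2 : a⁻¹ * b = 1 := (congrArg Subtype.val h1).symm
  exact inv_mul_eq_one.1 h2

/-- An element of `ℚ[H]` is determined by its images in the rings `F_χ[G]`. -/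
theorem charMap_injective {m : ℕ} {χ : Fin m → (Tors H →* ℂˣ)} (hχ : IsCompleteSetOfChars χ)
    (s : Splitting H) {x : MonoidAlgebra ℚ H} (hx : ∀ i, charMap s (χ i) x = 0) : x = 0 := by
  classical
  refine MonoidAlgebra.ext (Finsupp.ext fun h₀ => ?_)
  by_contra hne
  let S := x.coeff.support.filter fun h : H => (h : Free H) = (h₀ : Free H)
  have hS : (S : Set H) ⊆ {h : H | (h : Free H) = (h₀ : Free H)} := fun h hh =>
    (Finset.mem_filter.1 hh).2
  have hli : LinearIndepOn ℂ (fun (h : H) (ψ : Tors H →* ℂˣ) => (ψ (s.toHom h) : ℂ)) S :=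
    (linearIndependent_eval_char (Tors H)).comp (fun h : (S : Set H) => s.toHom h)
      fun a b hab => Subtype.ext (s.injOn_fiber _ (hS a.2) (hS b.2) hab)
  -- The coefficient at the coset of `h₀` vanishes for each representative, hence for every
  -- character `ψ` by Galois conjugation. This is a linear relation among evaluations at the
  -- distinct elements `s(h)`.
  have hsum : ∑ h ∈ S, ((x.coeff h : ℚ) : ℂ) • (fun ψ : Tors H →* ℂˣ => (ψ (s.toHom h) : ℂ)) =
      0 := by
    funext ψ
    obtain ⟨i, hi⟩ := hχ.complete ψ
    obtain ⟨τ, hτ⟩ := hi.map_eq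
    have h1 := coeff_charMap s (χ i) x (h₀ : Free H)
    rw [hx i] at h1
    have h2 := congrArg τ h1.symm
    simp only [map_sum, Algebra.smul_def, map_mul, hτ, eq_ratCast, map_ratCast,
      MonoidAlgebra.coeff_zero, Finsupp.zero_apply, map_zero] at h2
    simp only [Finset.sum_apply, Pi.smul_apply, smul_eq_mul, Pi.zero_apply]
    convert h2
  have h0 : h₀ ∈ S := Finset.mem_filter.2 ⟨Finsupp.mem_support_iff.2 hne, rfl⟩
  have := linearIndepOn_finset_iff.1 hli (fun h => ((x.coeff h : ℚ) : ℂ)) hsum h₀ h0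
  exact hne (by exact_mod_cast this)

/-- The homomorphism `ℚ[T] → F_χ` that extends a character. -/
noncomputable def charEval (χ : Tors H →* ℂˣ) :
    MonoidAlgebra ℚ (Tors H) →ₐ[ℚ] charField χ :=
  MonoidAlgebra.lift ℚ (charField χ) (Tors H) (charHom χ)

theorem charEval_single (χ : Tors H →* ℂˣ) (t : Tors H) (a : ℚ) :
    charEval χ (MonoidAlgebra.single t a) = a • charHom χ t :=
  MonoidAlgebra.lift_single _ _ _

theorem isOfFinOrder_char (χ : Tors H →* ℂˣ) (t : Tors H) : IsOfFinOrder (χ t) :=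
  χ.isOfFinOrder ((Tors H).subtype_injective.isOfFinOrder_iff.1 t.2)

/-- The values of `χ` are roots of unity, hence algebraic, so the field they generate is already the
`ℚ`-algebra they generate. -/
theorem charEval_surjective (χ : Tors H →* ℂˣ) : Function.Surjective (charEval χ) := by
  have halg : ∀ x ∈ Set.range fun t => (χ t : ℂ), IsAlgebraic ℚ x := by
    rintro _ ⟨t, rfl⟩
    obtain ⟨n, hn, ht⟩ := isOfFinOrder_iff_pow_eq_one.1 (isOfFinOrder_char χ t)
    refine IsIntegral.isAlgebraic (IsIntegral.of_pow hn ?_)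
    have : (χ t : ℂ) ^ n = 1 := congrArg Units.val ht
    rw [this]
    exact isIntegral_one
  have hle : Algebra.adjoin ℚ (Set.range fun t => (χ t : ℂ)) ≤
      ((charField χ).val.comp (charEval χ)).range := by
    rw [Algebra.adjoin_le_iff]
    rintro _ ⟨t, rfl⟩
    refine ⟨MonoidAlgebra.single t 1, ?_⟩
    change ((charEval χ (MonoidAlgebra.single t 1) : charField χ) : ℂ) = _
    rw [charEval_single, one_smul]
    rfl
  rintro ⟨y, hy⟩
  rw [← IntermediateField.mem_toSubalgebra,
    IntermediateField.adjoin_toSubalgebra_of_isAlgebraic halg] at hy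
  obtain ⟨x, hx⟩ := hle hy
  exact ⟨x, Subtype.ext hx⟩

/-- If `χ t` has order `n`, then `χ' t` is an `n`-th root of unity, thus a power of the primitive
root `χ t`. -/
theorem charField_le {χ χ' : Tors H →* ℂˣ} (h : ∀ t, χ t = 1 → χ' t = 1) :
    charField χ' ≤ charField χ := by
  rw [IntermediateField.adjoin_le_iff]
  rintro _ ⟨t, rfl⟩
  have hfin : IsOfFinOrder (χ t) := isOfFinOrder_char χ t
  have : NeZero (orderOf (χ t)) := ⟨hfin.orderOf_pos.ne'⟩
  have h1 : (χ' t : ℂ) ^ orderOf (χ t) = 1 := by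
    have : χ' (t ^ orderOf (χ t)) = 1 := h _ (by rw [map_pow, pow_orderOf_eq_one])
    rw [map_pow] at this
    exact congrArg Units.val this
  have hprim : IsPrimitiveRoot (χ t : ℂ) (orderOf (χ t)) :=
    IsPrimitiveRoot.coe_units_iff.2 (IsPrimitiveRoot.orderOf _)
  obtain ⟨i, -, hi⟩ := hprim.eq_pow_of_pow_eq_one h1
  change (χ' t : ℂ) ∈ charField χ
  rw [← hi]
  exact pow_mem (charHom χ t).2 i

theorem eq_one_iff_single_sub_one_mem_ker (χ : Tors H →* ℂˣ) (t : Tors H) :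
    χ t = 1 ↔ MonoidAlgebra.single t (1 : ℚ) - 1 ∈ RingHom.ker (charEval χ) := by
  rw [RingHom.mem_ker, map_sub, map_one, charEval_single, one_smul, sub_eq_zero,
    Subtype.ext_iff, Units.ext_iff]
  rfl

/-- The ideal determines which `t` satisfy `χ t = 1`, hence the field by `charField_le`. Both fields
are the quotient of `ℚ[T]` by this ideal, and the resulting isomorphism carries `χ t` to `χ' t`. -/
theorem charEquiv_of_ker_eq {χ χ' : Tors H →* ℂˣ}
    (h : RingHom.ker (charEval χ) = RingHom.ker (charEval χ')) : CharEquiv χ χ' := by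
  have h1 (t) : χ t = 1 ↔ χ' t = 1 := by
    rw [eq_one_iff_single_sub_one_mem_ker, eq_one_iff_single_sub_one_mem_ker, h]
  have h2 : charField χ = charField χ' :=
    le_antisymm (charField_le fun t => (h1 t).2) (charField_le fun t => (h1 t).1)
  let τ₀ : charField χ ≃ₐ[ℚ] charField χ' :=
    (Ideal.quotientKerAlgEquivOfSurjective (charEval_surjective χ)).symm.trans
      ((Ideal.quotientEquivAlgOfEq ℚ h).trans
        (Ideal.quotientKerAlgEquivOfSurjective (charEval_surjective χ')))
  have hτ₀ (x) : τ₀ (charEval χ x) = charEval χ' x := by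
    have : (Ideal.quotientKerAlgEquivOfSurjective (charEval_surjective χ)).symm (charEval χ x) =
        Ideal.Quotient.mk _ x := by
      rw [AlgEquiv.symm_apply_eq]
      rfl
    simp only [τ₀, AlgEquiv.trans_apply, this]
    rfl
  refine ⟨h2, τ₀.trans (IntermediateField.equivOfEq h2.symm), fun t => ?_⟩
  have h3 := hτ₀ (MonoidAlgebra.single t 1)
  rw [charEval_single, charEval_single, one_smul, one_smul] at h3
  exact congrArg (fun z : charField χ' => (z : ℂ)) h3

/-- Chinese remainder theorem: the kernels are maximal, and distinct because the characters are
inequivalent, so they are pairwise coprime. -/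
theorem exists_charEval_eq {m : ℕ} {χ : Fin m → (Tors H →* ℂˣ)} (hχ : IsCompleteSetOfChars χ)
    (c : ∀ i, charField (χ i)) : ∃ y, ∀ i, charEval (χ i) y = c i := by
  have hmax (i) : (RingHom.ker (charEval (χ i))).IsMaximal :=
    RingHom.ker_isMaximal_of_surjective _ (charEval_surjective (χ i))
  choose x hx using fun i => charEval_surjective (χ i) (c i)
  obtain ⟨y, hy⟩ := Ideal.exists_forall_sub_mem_ideal
    (I := fun i => RingHom.ker (charEval (χ i)))
    (fun i j hij => Ideal.isCoprime_of_isMaximal fun h =>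
      hij (hχ.inequivalent i j (charEquiv_of_ker_eq h))) x
  refine ⟨y, fun i => ?_⟩
  have := hy i
  rwa [RingHom.mem_ker, map_sub, sub_eq_zero, hx] at this

theorem charMap_mapDomain (s : Splitting H) (χ : Tors H →* ℂˣ) (y : MonoidAlgebra ℚ (Tors H)) :
    charMap s χ (MonoidAlgebra.mapDomainRingHom ℚ (Tors H).subtype y) =
      MonoidAlgebra.single 1 (charEval χ y) := by
  induction y using MonoidAlgebra.induction_linear with
  | zero => simp
  | add x y hx hy => rw [map_add, map_add, hx, hy, map_add, MonoidAlgebra.single_add]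
  | single t a =>
    have : ((t : H) : Free H) = 1 := (QuotientGroup.eq_one_iff _).2 t.2
    simp [charMap_single, charEval_single, s.apply_torsion, this]

/-- The homomorphism `ℚ[H] → ⨁ F_χ[G]` is surjective. -/
theorem exists_charMap_eq {m : ℕ} {χ : Fin m → (Tors H →* ℂˣ)} (hχ : IsCompleteSetOfChars χ)
    (s : Splitting H) (v : ∀ i, MonoidAlgebra (charField (χ i)) (Free H)) :
    ∃ x, ∀ i, charMap s (χ i) x = v i := by
  classical
  have hsingle (i) (w : MonoidAlgebra (charField (χ i)) (Free H)) :
      ∃ x, (fun j => charMap s (χ j) x) = Pi.single i w := by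
    induction w using MonoidAlgebra.induction_linear with
    | zero => exact ⟨0, by simp; rfl⟩
    | add w w' hw hw' =>
      obtain ⟨x, hx⟩ := hw
      obtain ⟨x', hx'⟩ := hw'
      refine ⟨x + x', ?_⟩
      rw [Pi.single_add, ← hx, ← hx']
      funext j
      exact map_add _ _ _
    | single g a =>
      induction g using QuotientGroup.induction_on with | _ h
      obtain ⟨y, hy⟩ := exists_charEval_eq hχ (Pi.single i a)
      -- The element `h * s(h)⁻¹` represents the same coset as `h` but lies in the kernel of `s`, so
      -- it maps to `[g]` with coefficient `1` in every component; `y` then selects the component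
      -- `i` and supplies `a`.
      refine ⟨MonoidAlgebra.mapDomainRingHom ℚ (Tors H).subtype y *
        MonoidAlgebra.single (h * (s.toHom h : H)⁻¹) 1, ?_⟩
      funext j
      have h1 : ((h * (s.toHom h : H)⁻¹ : H) : Free H) = (h : Free H) := by
        rw [QuotientGroup.eq]
        simp
      have h2 : s.toHom (h * (s.toHom h : H)⁻¹) = 1 := by
        rw [map_mul, map_inv, s.apply_torsion, mul_inv_cancel]
      rw [map_mul, charMap_mapDomain, charMap_single, h1, h2, map_one, one_smul,
        MonoidAlgebra.single_mul_single, one_mul, mul_one, hy]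
      by_cases hj : j = i
      · subst hj
        simp
      · simp [hj]
  choose x hx using fun i => hsingle i (v i)
  refine ⟨∑ i, x i, fun j => ?_⟩
  rw [map_sum, ← Finset.univ_sum_single v, Finset.sum_apply]
  exact Finset.sum_congr rfl fun i _ => congrFun (hx i) j

/-- Lift the units and their inverses separately; injectivity forces the two lifts to be mutually
inverse. -/
theorem exists_unit_charMap_eq {m : ℕ} {χ : Fin m → (Tors H →* ℂˣ)}
    (hχ : IsCompleteSetOfChars χ) (s : Splitting H)
    (v : ∀ i, (MonoidAlgebra (charField (χ i)) (Free H))ˣ) :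
    ∃ u : (MonoidAlgebra ℚ H)ˣ, ∀ i, charMap s (χ i) u = v i := by
  obtain ⟨x, hx⟩ := exists_charMap_eq hχ s fun i => (v i : MonoidAlgebra _ _)
  obtain ⟨y, hy⟩ := exists_charMap_eq hχ s fun i => ((v i)⁻¹ : (MonoidAlgebra _ _)ˣ)
  have hxy : x * y = 1 := by
    rw [← sub_eq_zero]
    refine charMap_injective hχ s fun i => ?_
    rw [map_sub, map_mul, hx, hy, map_one, Units.mul_inv, sub_self]
  exact ⟨Units.mkOfMulEqOne x y hxy, hx⟩

end Decomposition
universe u v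

/-! ### Assembling functions over an arbitrary complex and family of coefficient rings -/

section AbstractCoefficients

universe w

/-- The condition that `f` is zero, or computed by a presentation, depending on whether `X` is
trivial. -/
def IsComputedOrZero {A : Type*} [CommRing A] {M : Type*} [AddCommGroup M] [Module A M]
    (X : Type*) (d : ℤ) (f : (⋀[A]^(d.toNat) M) →ₗ[A] A) : Prop :=
  (Nontrivial X → f = 0) ∧ (Subsingleton X → IsComputedByPresentation d f)

theorem IsComputedOrZero.exists_unit {A : Type*} [CommRing A] {M : Type*} [AddCommGroup M]
    [Module A M] {X : Type*} {d : ℤ} {f f' : (⋀[A]^(d.toNat) M) →ₗ[A] A}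
    (hf : IsComputedOrZero X d f) (hf' : IsComputedOrZero X d f') :
    ∃ c : Aˣ, f' = (c : A) • f := by
  rcases subsingleton_or_nontrivial X with h | h
  · exact (hf.2 h).exists_unit (hf'.2 h)
  · exact ⟨1, by rw [hf.1 h, hf'.1 h, smul_zero]⟩

theorem IsComputedOrZero.transport {A : Type*} [CommRing A] {M M' : Type*} [AddCommGroup M]
    [Module A M] [AddCommGroup M'] [Module A M'] {X X' : Type*} {d : ℤ} {α : A ≃+* A}
    {θ : M ≃+ M'} (hθ : ∀ a x, θ (a • x) = α a • θ x) (e : X ≃ X')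
    {f : (⋀[A]^(d.toNat) M) →ₗ[A] A} {f' : (⋀[A]^(d.toNat) M') →ₗ[A] A}
    (hf' : ∀ u : Fin d.toNat → M', f' (exteriorPower.ιMulti A _ u) =
      α (f (exteriorPower.ιMulti A _ fun k => θ.symm (u k))))
    (hf : IsComputedOrZero X d f) : IsComputedOrZero X' d f' := by
  refine ⟨fun h => ?_, fun h => (hf.2 e.subsingleton).transport hθ hf'⟩
  refine exteriorPower.linearMap_ext (AlternatingMap.ext fun u => ?_)
  simp [hf', hf.1 e.nontrivial]

variable {R : Type u} [CommRing R] (C : ModuleComplex.{u, v} R) {A : Type w} [CommRing A]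
  (φ : R →+* A) {ι : Type*} {B : ι → Type w} [∀ i, CommRing (B i)] (d : ℤ)

/-- The function `f` on `⋀^d H_1(A ⊗ C)` is assembled from functions on `⋀^d H_1(B i ⊗ C)`, along
the ring homomorphisms `ψ i : A → B i`. -/
def IsAssembled (ψ : ∀ i, A →+* B i)
    (f : (⋀[A]^(d.toNat) (TwistedHomology C φ 1)) →ₗ[A] A) : Prop :=
  ∃ g : ∀ i, (⋀[B i]^(d.toNat) (TwistedHomology C ((ψ i).comp φ) 1)) →ₗ[B i] B i,
    (∀ i, IsComputedOrZero (TwistedHomology C ((ψ i).comp φ) 2) d (g i)) ∧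
    ∀ (i : ι) (u : Fin d.toNat → TwistedHomology C φ 1),
      ψ i (f (exteriorPower.ιMulti _ _ u)) =
        g i (exteriorPower.ιMulti _ _ (fun k => changeCoeff C φ (ψ i) 1 (u k)))

variable {C φ d}

/-- The component `g i` is replaced by its conjugate under `α i` and the induced map on homology.
The conjugation cancels against `ψ' i = α i ∘ ψ i`, so `f` itself is unchanged. -/
theorem IsAssembled.comp_equiv {ψ ψ' : ∀ i, A →+* B i} (α : ∀ i, B i ≃+* B i)
    (hα : ∀ i, ψ' i = (α i : B i →+* B i).comp (ψ i))
    {f : (⋀[A]^(d.toNat) (TwistedHomology C φ 1)) →ₗ[A] A} (hf : IsAssembled C φ d ψ f) :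
    IsAssembled C φ d ψ' f := by
  obtain ⟨g, hg, hfg⟩ := hf
  choose θ hθ hθc using fun i => exists_twistedHomology_equiv C φ (α i) (hα i) 1
  choose θ₂ _ using fun i => exists_twistedHomology_equiv C φ (α i) (hα i) 2
  choose g' hg' using fun i => exists_exteriorPower_transport (hθ i) (g i)
  refine ⟨g', fun i => (hg i).transport (hθ i) (θ₂ i).toEquiv (hg' i), fun i u => ?_⟩
  rw [hg']
  simp only [← hθc, AddEquiv.symm_apply_apply]
  rw [← hfg, hα]
  rfl

/-- The componentwise units lift to one unit of `A` by `hunit`, and `hinj` allows the identity to be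
checked after each `ψ i`. -/
theorem IsAssembled.exists_unit {ψ : ∀ i, A →+* B i}
    (hinj : ∀ x, (∀ i, ψ i x = 0) → x = 0)
    (hunit : ∀ v : ∀ i, (B i)ˣ, ∃ u : Aˣ, ∀ i, ψ i u = v i)
    {f f' : (⋀[A]^(d.toNat) (TwistedHomology C φ 1)) →ₗ[A] A} (hf : IsAssembled C φ d ψ f)
    (hf' : IsAssembled C φ d ψ f') : ∃ c : Aˣ, ∀ x, f' x = c * f x := by
  obtain ⟨g, hg, hfg⟩ := hf
  obtain ⟨g', hg', hfg'⟩ := hf'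
  choose v hv using fun i => (hg i).exists_unit (hg' i)
  obtain ⟨c, hc⟩ := hunit v
  suffices h : f' = (c : A) • f from ⟨c, fun x => LinearMap.congr_fun h x⟩
  refine exteriorPower.linearMap_ext (AlternatingMap.ext fun u => ?_)
  simp only [LinearMap.compAlternatingMap_apply, LinearMap.smul_apply, smul_eq_mul]
  rw [← sub_eq_zero]
  refine hinj _ fun i => ?_
  rw [map_sub, map_mul, hfg, hfg', hc, hv, LinearMap.smul_apply, smul_eq_mul, sub_self]

end AbstractCoefficients

/-! ### Return to Alexander functions of sutured cobordisms -/

section SuturedCobordisms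

variable {Y : Type u} [TopologicalSpace Y] {P : MaximalAbelianCover.{u, v} Y} {R : Set Y}

theorem isAlexanderFunctionQH_iff_isAssembled {m : ℕ} (χ : Fin m → (Tors (H1 Y) →* ℂˣ))
    (s : Splitting (H1 Y))
    (f : (⋀[MonoidAlgebra ℚ (H1 Y)]^((deficiency R).toNat) (HomologyQH P R 1))
      →ₗ[MonoidAlgebra ℚ (H1 Y)] MonoidAlgebra ℚ (H1 Y)) :
    IsAlexanderFunctionQH P R χ s f ↔
      IsAssembled (coverComplex P R) (intToRat (H1 Y)) (deficiency R)
        (fun i => charMap s (χ i)) f := Iff.rfl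

theorem IsAlexanderFunctionQH.change_splitting {m : ℕ} {χ : Fin m → (Tors (H1 Y) →* ℂˣ)}
    {s : Splitting (H1 Y)} (s' : Splitting (H1 Y))
    {f : (⋀[MonoidAlgebra ℚ (H1 Y)]^((deficiency R).toNat) (HomologyQH P R 1))
      →ₗ[MonoidAlgebra ℚ (H1 Y)] MonoidAlgebra ℚ (H1 Y)}
    (hf : IsAlexanderFunctionQH P R χ s f) : IsAlexanderFunctionQH P R χ s' f := by
  rw [isAlexanderFunctionQH_iff_isAssembled] at hf ⊢
  choose α hα using fun i => exists_charMap_eq_comp s s' (χ i)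
  exact hf.comp_equiv α hα

end SuturedCobordisms

end SuturedAlexander

theorem proposition10
    {F₀ F₁ Y : Type*} [TopologicalSpace F₀] [TopologicalSpace F₁] [TopologicalSpace Y]
    {S₀ : SuturedSurface F₀} {S₁ : SuturedSurface F₁} (W : SuturedCobordism S₀ S₁ Y)
    [ConnectedSpace Y] (P : MaximalAbelianCover Y)
    {m : ℕ} (χ : Fin m → (Tors (H1 Y) →* ℂˣ)) (hχ : IsCompleteSetOfChars χ)
    (s s' : Splitting (H1 Y)) :
    (∀ A, IsAlexanderFunctionQH P W.Rp χ s A ↔ IsAlexanderFunctionQH P W.Rp χ s' A) ∧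
    (∀ A A', IsAlexanderFunctionQH P W.Rp χ s A → IsAlexanderFunctionQH P W.Rp χ s' A' →
      ∃ u : (MonoidAlgebra ℚ (H1 Y))ˣ, ∀ x, A' x = (u : MonoidAlgebra ℚ (H1 Y)) * A x) := by
  refine ⟨fun A => ⟨fun h => h.change_splitting s', fun h => h.change_splitting s⟩,
    fun A A' h h' => ?_⟩
  -- `A'` is also an Alexander function for `s`, so only the choice of presentations for one
  -- splitting is left to compare.
  exact IsAssembled.exists_unit (fun x => charMap_injective hχ s) (exists_unit_charMap_eq hχ s)
    h (h'.change_splitting s)
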